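/- Let $[n]=\{1,\dots,n\}$, and order $[n]^d$ coordinatewise. For $f,g:[n]^d\to\{0,1\}$ let $\Delta(f,g)$ be the fraction of points of $[n]^d$ at which $f$ and $g$ differ, and let $\varepsilon_f=\min\{\Delta(f,g): g:[n]^d\to\{0,1\}\text{ monotone}\}$; $f$ is called $\varepsilon$-far from monotone if $\varepsilon_f\ge\varepsilon$. The fully augmented hypergrid is the undirected graph on $[n]^d$ in which two points are joined by an edge if and only if they differ in exactly one coordinate; let $E$ be its edge set. An $i$-aligned violation of $f$ is a pair $\{x,y\}$ of points that differ in the $i$-th coordinate only and satisfy $x_i<y_i$, $f(x)=1$, $f(y)=0$. For $\chi:E\to\{0,1\}$ and $x\in[n]^d$ let $\Phi_{f,\chi}(x)$ be the number of $i\in\{1,\dots,d\}$ for which there is an $i$-aligned violation of $f$ that contains $x$ (as either endpoint) and whose color under $\chi$ is equal to $f(x)$. **Theorem 1.2.** There is an absolute constant $C>0$ such that for all integers $n\ge 2$ and $d\ge 0$, every $f:[n]^d\to\{0,1\}$, every coloring $\chi:E\to\{0,1\}$ and every real $\varepsilon>0$ such that $f$ is $\varepsilon$-far from monotone, $$\mathbf{E}_{x\in[n]^d}\left[\sqrt{\Phi_{f,\chi}(x)}\right]\;\ge\;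 C\cdot\frac{\varepsilon}{\log n},$$ where $x$ is uniformly distributed in $[n]^d$ and $\log$ is the natural logarithm. -/

import Mathlib

namespace Hypergrid

/-- The hypergrid `[n]^d` with its coordinatewise partial order. The chain `[n] = {1, …, n}` is
represented by the isomorphic chain `Fin n`. -/
abbrev Point (n d : ℕ) : Type := Fin d → Fin n

/-- A Boolean function on the hypergrid; `false` stands for `0`, `true` for `1`, `false < true`. -/
abbrev BoolFn (n d : ℕ) : Type := Point n d → Bool

variable {n d : ℕ}

/-- `x` and `y` differ in coordinate `i` and in no other coordinate. -/
def Aligned (i : Fin d) (x y : Point n d) : Prop :=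
  x i ≠ y i ∧ ∀ j, j ≠ i → x j = y j

theorem Aligned.symm {i : Fin d} {x y : Point n d} (h : Aligned i x y) : Aligned i y x :=
  ⟨h.1.symm, fun j hj => (h.2 j hj).symm⟩

/-- The fully augmented hypergrid: the undirected graph on `[n]^d` in which two points are
adjacent iff they differ in exactly one coordinate. -/
def augmented (n d : ℕ) : SimpleGraph (Point n d) where
  Adj x y := ∃ i, Aligned i x y
  symm := ⟨fun _ _ ⟨i, h⟩ => ⟨i, h.symm⟩⟩
  loopless := ⟨fun _ ⟨_, h⟩ => h.1 rfl⟩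

/-- A `0/1`-coloring of the (undirected) edges of the fully augmented hypergrid. -/
abbrev Coloring (n d : ℕ) : Type := (augmented n d).edgeSet → Bool

/-- The edge joining two aligned points. -/
def Aligned.edge {i : Fin d} {x y : Point n d} (h : Aligned i x y) : (augmented n d).edgeSet :=
  ⟨s(x, y), (SimpleGraph.mem_edgeSet _).2 ⟨i, h⟩⟩

/-- The unordered pair `x`, `y` violates monotonicity of `f`: the points are comparable, and `f`
is `1` at the smaller one and `0` at the larger one. -/
def Violation (f : BoolFn n d) (x y : Point n d) : Prop :=
  (x ≤ y ∧ f x = true ∧ f y = false) ∨ (y ≤ x ∧ f y = true ∧ f x = false)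

open Classical in
/-- `Φ_{f,χ}(x; i)`: equals `1` if some `i`-aligned violation containing `x` has color `f x`,
and `0` otherwise. -/
noncomputable def influenceAt (f : BoolFn n d) (χ : Coloring n d) (x : Point n d) (i : Fin d) : ℕ :=
  if ∃ (y : Point n d) (h : Aligned i x y), Violation f x y ∧ χ h.edge = f x then 1 else 0

/-- The colorful thresholded negative influence `Φ_{f,χ}(x)`. -/
noncomputable def influence (f : BoolFn n d) (χ : Coloring n d) (x : Point n d) : ℕ :=
  ∑ i, influenceAt f χ x i

/-- The expectation of `√Φ_{f,χ}(x)` over a uniformly random point `x` of `[n]^d`. -/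
noncomputable def talagrandObjective (f : BoolFn n d) (χ : Coloring n d) : ℝ :=
  (∑ x : Point n d, √(influence f χ x : ℝ)) / (n : ℝ) ^ d

/-- The fraction of the points of `[n]^d` at which `f` and `g` differ. -/
noncomputable def dist (f g : BoolFn n d) : ℝ :=
  ((Finset.univ.filter fun x => f x ≠ g x).card : ℝ) / (n : ℝ) ^ d

/-- The distance to monotonicity `ε_f`: the infimum, over the finite nonempty set of monotone
functions (so a minimum), of the distance to `f`. -/
noncomputable def distToMonotone (f : BoolFn n d) : ℝ :=
  ⨅ g : {g : BoolFn n d // Monotone g}, dist f g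

/-- `f` is `ε`-far from monotone. -/
def IsFar (ε : ℝ) (f : BoolFn n d) : Prop := ε ≤ distToMonotone f

end Hypergrid

open Finset BigOperators

namespace Hypergrid

/-! Call `x` marked in direction `i` when `i` contributes to `influence f χ x`. Every violation in
direction `i` has a marked endpoint, so the marks are encoded by functions `U i ≤ f ≤ L i` with
`Below i (U i) (L i)` (`isCover_coloring`). Sorting `U`, `f` and `L` along a direction keeps their
order and does not increase `markSum` (`markSum_sortAlong_le`), because nested sets minimise sums of
square roots of multiplicities.

Now label the directions at random by a finite set `Ω` and sort `f` along one class. At a fixed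
point this is a 0/1 function of the labelling, and relabelling `i` changes it only if the sorted `U
i` and `L i` differ there for the old or the new labelling. The Talagrand-type inequality
`variance_le_mean_sqrt` bounds its variance by the marks, so sortings along different classes are
close on average, and sorting one of them along all classes moves it little
(`exists_below_labelClass`).

There remains the distance from `f` to its sorting along one class. The inequality being proved,
applied to that class, controls it, and the class has on average at most `1/√|Ω|` of the `markSum`.
With 16 labels a constant `K` improves to `K/2 + 2048` (`DistBound.improve`); iteration gives 4096,
with no loss in `n`. -/

/-! ### Concavity of the square root and nested families -/

theorem sqrt_succ_sub_sqrt_antitone {m k : ℕ} (h : m ≤ k) :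
    √((k : ℝ) + 1) - √(k : ℝ) ≤ √((m : ℝ) + 1) - √(m : ℝ) := by
  have key : ∀ t : ℝ, 0 ≤ t → √(t + 1) - √t = (√(t + 1) + √t)⁻¹ := by
    intro t ht
    have h1 : 0 < √(t + 1) := Real.sqrt_pos.2 (by linarith)
    have h2 := Real.sqrt_nonneg t
    apply eq_inv_of_mul_eq_one_left
    nlinarith [Real.sq_sqrt ht, Real.sq_sqrt (show 0 ≤ t + 1 by linarith)]
  rw [key _ (Nat.cast_nonneg k), key _ (Nat.cast_nonneg m)]
  have hmk : (m : ℝ) ≤ k := by exact_mod_cast h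
  have h1 : 0 < √((m : ℝ) + 1) := Real.sqrt_pos.2 (by positivity)
  gcongr

/-- Among families of sets of prescribed sizes, nested families minimise the sum of the square
roots of the multiplicities. -/
theorem sum_sqrt_le_of_nested {α ι : Type*} [Fintype α] [DecidableEq α] [DecidableEq ι]
    (s : Finset ι) (V V' : ι → Finset α) (hcard : ∀ i ∈ s, (V' i).card = (V i).card)
    (hnest : ∀ i ∈ s, ∀ j ∈ s, V' i ⊆ V' j ∨ V' j ⊆ V' i) :
    ∑ a, √((s.filter fun i => a ∈ V' i).card : ℝ) ≤
      ∑ a, √((s.filter fun i => a ∈ V i).card : ℝ) := by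
  induction s using Finset.induction_on_min_value (fun i => (V' i).card) with
  | empty => simp
  | insert i s his hmin ih =>
    have ih' := ih (fun j hj => hcard j (mem_insert_of_mem hj))
      (fun j hj k hk => hnest j (mem_insert_of_mem hj) k (mem_insert_of_mem hk))
    have hsub : ∀ j ∈ s, V' i ⊆ V' j := by
      intro j hj
      rcases hnest i (mem_insert_self _ _) j (mem_insert_of_mem hj) with h | h
      · exact h
      · exact (Finset.eq_of_subset_of_card_le h (hmin j hj)).symm.subset
    have split : ∀ (Y : ι → Finset α) (a : α),
        √(((insert i s).filter fun j => a ∈ Y j).card : ℝ) =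
          √((s.filter fun j => a ∈ Y j).card : ℝ) + if a ∈ Y i then
            √(((s.filter fun j => a ∈ Y j).card : ℝ) + 1) -
              √((s.filter fun j => a ∈ Y j).card : ℝ) else 0 := by
      intro Y a
      rw [filter_insert]
      split_ifs with h
      · rw [card_insert_of_notMem (by simp [his])]
        push_cast
        ring
      · simp
    -- The smallest set is added last. In the nested family all other sets contain it, so every
    -- increment is `k`, the least possible increment for any family.
    set k : ℝ := √((s.card : ℝ) + 1) - √(s.card : ℝ) with hk
    have e1 : ∑ a, √(((insert i s).filter fun j => a ∈ V' j).card : ℝ) =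
        ∑ a, √((s.filter fun j => a ∈ V' j).card : ℝ) + (V' i).card * k := by
      simp_rw [split V', sum_add_distrib]
      congr 1
      rw [← sum_filter, filter_mem_eq_inter, univ_inter, ← nsmul_eq_mul, ← sum_const]
      refine sum_congr rfl fun a ha => ?_
      rw [filter_true_of_mem fun j hj => hsub j hj ha]
    have e2 : ∑ a, √((s.filter fun j => a ∈ V j).card : ℝ) + (V i).card * k ≤
        ∑ a, √(((insert i s).filter fun j => a ∈ V j).card : ℝ) := by
      simp_rw [split V, sum_add_distrib]
      gcongr
      rw [← sum_filter, filter_mem_eq_inter, univ_inter, ← nsmul_eq_mul, ← sum_const]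
      exact sum_le_sum fun a _ => sqrt_succ_sub_sqrt_antitone (card_filter_le _ _)
    rw [e1, hcard i (mem_insert_self _ _)]
    linarith

/-! ### Means and a robust Talagrand inequality on product spaces -/

section Talagrand

variable {Ω : Type*} [Fintype Ω]

/-- The mean of a real function on a finite type. -/
noncomputable def mean {α : Type*} [Fintype α] (F : α → ℝ) : ℝ :=
  (∑ a, F a) / Fintype.card α

section mean
variable {α : Type*} [Fintype α]

theorem mean_mono {F G : α → ℝ} (h : ∀ a, F a ≤ G a) : mean F ≤ mean G :=
  div_le_div_of_nonneg_right (sum_le_sum fun a _ => h a) (Nat.cast_nonneg _)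

theorem mean_nonneg {F : α → ℝ} (h : ∀ a, 0 ≤ F a) : 0 ≤ mean F :=
  div_nonneg (sum_nonneg fun a _ => h a) (Nat.cast_nonneg _)

theorem mean_add (F G : α → ℝ) : mean (fun a => F a + G a) = mean F + mean G := by
  simp only [mean, sum_add_distrib, add_div]

theorem mean_sub (F G : α → ℝ) : mean (fun a => F a - G a) = mean F - mean G := by
  simp only [mean, sum_sub_distrib, sub_div]

theorem mean_mul_left (r : ℝ) (F : α → ℝ) : mean (fun a => r * F a) = r * mean F := by
  simp only [mean, ← mul_sum, mul_div_assoc]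

theorem mean_const [Nonempty α] (r : ℝ) : mean (fun _ : α => r) = r := by
  have : (Fintype.card α : ℝ) ≠ 0 := by exact_mod_cast Fintype.card_ne_zero
  simp only [mean, sum_const, card_univ, nsmul_eq_mul]
  field_simp

theorem mean_sum {β : Type*} (s : Finset β) (F : β → α → ℝ) :
    mean (fun a => ∑ b ∈ s, F b a) = ∑ b ∈ s, mean (F b) := by
  simp only [mean, sum_comm (s := univ) (t := s), sum_div]

theorem mean_equiv {β : Type*} [Fintype β] (e : α ≃ β) (F : β → ℝ) :
    mean (fun a => F (e a)) = mean F := by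
  simp only [mean, Fintype.card_congr e, e.sum_comp]

theorem exists_le_mean [Nonempty α] (F : α → ℝ) : ∃ a, F a ≤ mean F := by
  by_contra! h
  have hc : (0 : ℝ) < Fintype.card α := by exact_mod_cast Fintype.card_pos
  have : ∑ _a : α, mean F < ∑ a, F a := sum_lt_sum_of_nonempty univ_nonempty fun a _ => h a
  rw [sum_const, card_univ, nsmul_eq_mul, mean, mul_div_cancel₀ _ hc.ne'] at this
  exact lt_irrefl _ this

theorem abs_mean_le (F : α → ℝ) : |mean F| ≤ mean fun a => |F a| := by
  rw [mean, abs_div, Nat.abs_cast]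
  exact div_le_div_of_nonneg_right (abs_sum_le_sum_abs _ _) (Nat.cast_nonneg _)

theorem mean_sq_sub (F : α → ℝ) [Nonempty α] :
    mean (fun a => (F a - mean F) ^ 2) = mean (fun a => F a ^ 2) - mean F ^ 2 := by
  have : (fun a => (F a - mean F) ^ 2) =
      fun a => (F a ^ 2 - (2 * mean F) * F a) + mean F ^ 2 := by
    funext a; ring
  rw [this, mean_add, mean_sub, mean_mul_left, mean_const]
  ring

/-- Turns a variance bound into a bound on the disagreement of two independent samples. -/
theorem mean_mean_sq_sub (F : α → ℝ) [Nonempty α] :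
    mean (fun a => mean fun b => (F a - F b) ^ 2) =
      2 * (mean (fun a => F a ^ 2) - mean F ^ 2) := by
  have : ∀ a, (mean fun b => (F a - F b) ^ 2) =
      (F a ^ 2 - (2 * mean F) * F a) + mean fun b => F b ^ 2 := by
    intro a
    have : (fun b => (F a - F b) ^ 2) = fun b => (F a ^ 2 - (2 * F a) * F b) + F b ^ 2 := by
      funext b; ring
    rw [this, mean_add, mean_sub, mean_mul_left, mean_const]
    ring
  simp_rw [this]
  rw [mean_add, mean_sub, mean_mul_left, mean_const]
  ring

/-- Jensen's inequality for the square root. -/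
theorem mean_sqrt_le (F : α → ℝ) (hF : ∀ a, 0 ≤ F a) [Nonempty α] :
    mean (fun a => √(F a)) ≤ √(mean F) := by
  apply Real.le_sqrt_of_sq_le
  have h := mean_sq_sub fun a => √(F a)
  have h0 : 0 ≤ mean fun a => (√(F a) - mean fun a => √(F a)) ^ 2 :=
    mean_nonneg fun a => sq_nonneg _
  have h1 : (fun a => √(F a) ^ 2) = F := funext fun a => Real.sq_sqrt (hF a)
  rw [h1] at h
  linarith

/-- The norm of a mean of plane vectors is at most the mean of the norms. -/
theorem sqrt_mean_le (X Y : α → ℝ) :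
    √(mean X ^ 2 + mean Y ^ 2) ≤ mean fun a => √(X a ^ 2 + Y a ^ 2) := by
  set r := √(mean X ^ 2 + mean Y ^ 2) with hr
  have hr2 : r ^ 2 = mean X ^ 2 + mean Y ^ 2 := Real.sq_sqrt (by positivity)
  rcases (Real.sqrt_nonneg (mean X ^ 2 + mean Y ^ 2)).eq_or_lt with h0 | h0
  · rw [← hr] at h0
    rw [← h0]
    exact mean_nonneg fun a => Real.sqrt_nonneg _
  · rw [← hr] at h0
    have h : ∀ a, mean X * X a + mean Y * Y a ≤ r * √(X a ^ 2 + Y a ^ 2) := by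
      intro a
      rw [hr, ← Real.sqrt_mul (by positivity)]
      apply Real.le_sqrt_of_sq_le
      nlinarith [sq_nonneg (mean X * Y a - mean Y * X a)]
    have h' := mean_mono h
    rw [mean_add, mean_mul_left, mean_mul_left, mean_mul_left] at h'
    nlinarith

theorem mean_variance_bounds (F : α → ℝ) [Nonempty α] (h0 : ∀ a, 0 ≤ F a) (h1 : ∀ a, F a ≤ 1) :
    0 ≤ mean (fun a => F a ^ 2) - mean F ^ 2 ∧
      mean (fun a => F a ^ 2) - mean F ^ 2 ≤ 1 / 4 := by
  constructor
  · rw [← mean_sq_sub]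
    exact mean_nonneg fun a => sq_nonneg _
  · have : mean (fun a => F a ^ 2) ≤ mean F :=
      mean_mono fun a => by nlinarith [h0 a, h1 a]
    nlinarith [sq_nonneg (mean F - 1 / 2)]

theorem mean_cons (d : ℕ) (F : (Fin (d + 1) → Ω) → ℝ) :
    mean F = mean fun a => mean fun c : Fin d → Ω => F (Fin.cons a c) := by
  rw [← mean_equiv (Fin.consEquiv fun _ => Ω)]
  simp only [mean, Fintype.card_prod, Fintype.sum_prod_type, ← sum_div, Nat.cast_mul, div_div,
    Fin.consEquiv, Equiv.coe_fn_mk]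
  rw [mul_comm]

end mean

/-- A robust form of Talagrand's isoperimetric inequality on a finite product space: the variation
of `g` along each edge may be charged to the two end points of the edge in an arbitrary way. -/
theorem variance_le_mean_sqrt [Nonempty Ω] (d : ℕ) (g : (Fin d → Ω) → ℝ)
    (h0 : ∀ c, 0 ≤ g c) (h1 : ∀ c, g c ≤ 1) (W : Fin d → (Fin d → Ω) → ℝ)
    (hW0 : ∀ i c, 0 ≤ W i c)
    (hW : ∀ i c a, |g c - g (Function.update c i a)| ≤ W i c + W i (Function.update c i a)) :
    mean (fun c => g c ^ 2) - mean g ^ 2 ≤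
      Fintype.card Ω * mean fun c => √(∑ i, W i c ^ 2) := by
  classical
  induction d with
  | zero =>
    have e : ∀ F : (Fin 0 → Ω) → ℝ, mean F = F default := by
      intro F
      simp [mean]
    simp [e]
  | succ d ih =>
    set q : ℝ := (Fintype.card Ω : ℝ) with hq
    have hq1 : 1 ≤ q := Nat.one_le_cast.2 Fintype.card_pos
    let μ : Ω → ℝ := fun a => mean fun c : Fin d → Ω => g (Fin.cons a c)
    let w : Ω → ℝ := fun a => mean fun c : Fin d → Ω => W 0 (Fin.cons a c)
    let X : Ω → (Fin d → Ω) → ℝ := fun a c => √(∑ i : Fin d, W i.succ (Fin.cons a c) ^ 2)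
    have ih' : ∀ a, (mean fun c : Fin d → Ω => g (Fin.cons a c) ^ 2) - μ a ^ 2 ≤
        q * mean (X a) := by
      intro a
      refine ih (fun c => g (Fin.cons a c)) (fun c => h0 _) (fun c => h1 _)
        (fun i c => W i.succ (Fin.cons a c)) (fun i c => hW0 _ _) (fun i c b => ?_)
      rw [Fin.cons_update]
      exact hW _ _ _
    have hw0 : ∀ a, 0 ≤ w a := fun a => mean_nonneg fun c => hW0 _ _
    have hμ : ∀ a b, |μ a - μ b| ≤ q * mean w := by
      intro a b
      have hqw : q * mean w = ∑ a, w a := mul_div_cancel₀ _ (by positivity)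
      rw [hqw]
      -- For distinct labels, `w a + w b` is part of the full sum of `w`. Passing from this sum to
      -- the mean costs the factor `q`.
      by_cases hab : a = b
      · subst hab
        simpa using sum_nonneg fun a _ => hw0 a
      · calc |μ a - μ b| ≤ mean fun c : Fin d → Ω =>
              |g (Fin.cons a c) - g (Fin.cons b c)| := by
              rw [← mean_sub]; exact abs_mean_le _
          _ ≤ w a + w b := by
              rw [← mean_add]
              refine mean_mono fun c => ?_
              have := hW 0 (Fin.cons a c) b
              rwa [Fin.update_cons_zero] at this
          _ = ∑ t ∈ {a, b}, w t := (sum_pair hab).symm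
          _ ≤ ∑ t, w t := sum_le_sum_of_subset_of_nonneg (subset_univ _) fun t _ _ => hw0 t
    set v : ℝ := mean (fun a => μ a ^ 2) - mean μ ^ 2 with hv
    have hv' : v ≤ (q * mean w) ^ 2 := by
      rw [hv, ← mean_sq_sub, ← mean_const (α := Ω) ((q * mean w) ^ 2)]
      refine mean_mono fun a => ?_
      rw [sq_le_sq, abs_of_nonneg (mul_nonneg (by linarith) (mean_nonneg hw0))]
      have e : μ a - mean μ = mean fun b => μ a - μ b := by rw [mean_sub, mean_const]
      rw [e]
      refine (abs_mean_le _).trans ?_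
      rw [← mean_const (α := Ω) (q * mean w)]
      exact mean_mono fun b => hμ a b
    have hvb : 0 ≤ v ∧ v ≤ 1 / 4 :=
      mean_variance_bounds μ (fun a => mean_nonneg fun c => h0 _)
        (fun a => (mean_mono fun c => h1 _).trans_eq (mean_const 1))
    let A : Ω → ℝ := fun a => (mean fun c : Fin d → Ω => g (Fin.cons a c) ^ 2) - μ a ^ 2
    have hA : ∀ a, 0 ≤ A a ∧ A a ≤ 1 / 4 := fun a =>
      mean_variance_bounds (fun c : Fin d → Ω => g (Fin.cons a c)) (fun c => h0 _) (fun c => h1 _)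
    have hA0 : 0 ≤ mean A := mean_nonneg fun a => (hA a).1
    have hA1 : mean A ≤ 1 / 4 := (mean_mono fun a => (hA a).2).trans_eq (mean_const _)
    have hAX : mean A ≤ q * mean fun a => mean (X a) := by
      rw [← mean_mul_left]
      exact mean_mono ih'
    have hvar : mean (fun c => g c ^ 2) - mean g ^ 2 = mean A + v := by
      rw [mean_cons d g, mean_cons d fun c => g c ^ 2, hv, mean_sub]
      ring
    -- The norm inequality is used twice: for the mean over the first coordinate, then for the mean
    -- over the others.
    have hmain : √((mean fun a => mean (X a)) ^ 2 + mean w ^ 2) ≤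
        mean fun c => √(∑ i, W i c ^ 2) := by
      rw [mean_cons d fun c => √(∑ i, W i c ^ 2)]
      refine (sqrt_mean_le _ _).trans (mean_mono fun a => (sqrt_mean_le _ _).trans_eq ?_)
      congr 1
      funext c
      rw [Fin.sum_univ_succ, Real.sq_sqrt (sum_nonneg fun i _ => sq_nonneg _), add_comm]
    rw [hvar]
    calc mean A + v ≤ √((q * mean fun a => mean (X a)) ^ 2 + (q * mean w) ^ 2) := by
          apply Real.le_sqrt_of_sq_le
          -- Both variances are at most 1/4, so `2 * mean A + v ≤ 1` and `(mean A + v)² ≤ mean A² +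
          -- v`.
          have : mean A ^ 2 ≤ (q * mean fun a => mean (X a)) ^ 2 := by gcongr
          nlinarith [hvb.1, hvb.2]
      _ = q * √((mean fun a => mean (X a)) ^ 2 + mean w ^ 2) := by
          rw [mul_pow, mul_pow, ← mul_add, Real.sqrt_mul (by positivity),
            Real.sqrt_sq (by linarith)]
      _ ≤ _ := by gcongr

end Talagrand

variable {n d : ℕ}

/-! ### Sorting sets on a single line -/

section Line

/-- The `k` largest elements of `Fin n`, for `k ≤ n`. -/
def topSet (n k : ℕ) : Finset (Fin n) := univ.filter fun a => n ≤ k + a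

theorem mem_topSet {k : ℕ} {a : Fin n} : a ∈ topSet n k ↔ n ≤ k + a := by
  simp [topSet]

theorem topSet_mono {k l : ℕ} (h : k ≤ l) : topSet n k ⊆ topSet n l := by
  intro a
  simp only [mem_topSet]
  omega

theorem card_topSet {k : ℕ} (h : k ≤ n) : (topSet n k).card = k := by
  have e : topSet n k = univ.filter fun a : Fin n => n - k ≤ (a : ℕ) := by
    ext a
    simp only [mem_topSet, mem_filter, mem_univ, true_and]
    omega
  have h1 := card_filter_add_card_filter_not (s := (univ : Finset (Fin n)))
    fun a : Fin n => (a : ℕ) < n - k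
  have h2 : (univ.filter fun a : Fin n => (a : ℕ) < n - k).card = n - k := by
    rw [Fin.card_filter_val_lt]
    omega
  rw [h2] at h1
  simp only [not_lt, card_univ, Fintype.card_fin] at h1
  rw [e]
  omega

theorem card_topSet_sdiff (A B : Finset (Fin n)) (h : A ⊆ B) :
    (topSet n B.card \ topSet n A.card).card = (B \ A).card := by
  have hA := card_finset_fin_le A
  have hB := card_finset_fin_le B
  rw [card_sdiff_of_subset (topSet_mono (card_le_card h)), card_sdiff_of_subset h,
    card_topSet hA, card_topSet hB]

/-- Sorted sets are nested, so they differ in exactly the difference of the cardinalities, which no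
pair of sets of these sizes can beat. -/
theorem card_topSet_ne_le (A B : Finset (Fin n)) :
    (univ.filter fun a => ¬(a ∈ topSet n A.card ↔ a ∈ topSet n B.card)).card ≤
      (univ.filter fun a => ¬(a ∈ A ↔ a ∈ B)).card := by
  wlog h : A.card ≤ B.card generalizing A B
  · have := this B A (by omega)
    simpa only [iff_comm] using this
  have e : (univ.filter fun a => ¬(a ∈ topSet n A.card ↔ a ∈ topSet n B.card)) =
      topSet n B.card \ topSet n A.card := by
    ext a
    have := @topSet_mono n _ _ h a
    simp only [mem_filter, mem_univ, true_and, mem_sdiff]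
    tauto
  rw [e, card_sdiff_of_subset (topSet_mono h), card_topSet (card_finset_fin_le A),
    card_topSet (card_finset_fin_le B)]
  refine (le_card_sdiff A B).trans (card_le_card fun a => ?_)
  simp only [mem_filter, mem_univ, true_and, mem_sdiff]
  tauto

/-- Sorting sets `U i ⊆ F ⊆ L i` along a line does not increase the sum of the square roots of
the numbers of indices that separate `U i` from `L i`. -/
theorem sum_sqrt_topSet_le {ι : Type*} [DecidableEq ι] (s : Finset ι) (F : Finset (Fin n))
    (U L : ι → Finset (Fin n)) (hU : ∀ i ∈ s, U i ⊆ F) (hL : ∀ i ∈ s, F ⊆ L i) :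
    ∑ a, √((s.filter fun i => a ∈ topSet n (L i).card \ topSet n (U i).card).card : ℝ) ≤
      ∑ a, √((s.filter fun i => a ∈ L i \ U i).card : ℝ) := by
  -- A point of `F` can only be separated from below, by `F \ U i`, and a point outside only from
  -- above, by `L i \ F`. Each family becomes nested after sorting.
  have split : ∀ (F : Finset (Fin n)) (U L : ι → Finset (Fin n)), (∀ i ∈ s, U i ⊆ F) →
      (∀ i ∈ s, F ⊆ L i) → ∀ a, √((s.filter fun i => a ∈ L i \ U i).card : ℝ) =
        √((s.filter fun i => a ∈ F \ U i).card : ℝ) +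
          √((s.filter fun i => a ∈ L i \ F).card : ℝ) := by
    intro F U L hU hL a
    by_cases ha : a ∈ F
    · have e1 : (s.filter fun i => a ∈ L i \ F) = ∅ := by simp [ha]
      have e2 : (s.filter fun i => a ∈ L i \ U i) = s.filter fun i => a ∈ F \ U i :=
        filter_congr fun i hi => by simp [ha, hL i hi ha]
      rw [e1, e2]; simp
    · have e1 : (s.filter fun i => a ∈ F \ U i) = ∅ := by simp [ha]
      have e2 : (s.filter fun i => a ∈ L i \ U i) = s.filter fun i => a ∈ L i \ F :=
        filter_congr fun i hi => by
          have : a ∉ U i := fun h => ha (hU i hi h)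
          simp [ha, this]
      rw [e1, e2]; simp
  rw [sum_congr rfl fun a _ => split F U L hU hL a,
    sum_congr rfl fun a _ => split (topSet n F.card) (fun i => topSet n (U i).card)
      (fun i => topSet n (L i).card) (fun i hi => topSet_mono (card_le_card (hU i hi)))
      (fun i hi => topSet_mono (card_le_card (hL i hi))) a,
    sum_add_distrib, sum_add_distrib]
  refine add_le_add
    (sum_sqrt_le_of_nested s (fun i => F \ U i) (fun i => topSet n F.card \ topSet n (U i).card)
      (fun i hi => card_topSet_sdiff _ _ (hU i hi)) fun i _ j _ => ?_)
    (sum_sqrt_le_of_nested s (fun i => L i \ F) (fun i => topSet n (L i).card \ topSet n F.card)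
      (fun i hi => card_topSet_sdiff _ _ (hL i hi)) fun i _ j _ => ?_)
  · rcases le_total (U i).card (U j).card with h | h
    · exact Or.inr (sdiff_subset_sdiff Subset.rfl (topSet_mono h))
    · exact Or.inl (sdiff_subset_sdiff Subset.rfl (topSet_mono h))
  · rcases le_total (L i).card (L j).card with h | h
    · exact Or.inl (sdiff_subset_sdiff (topSet_mono h) Subset.rfl)
    · exact Or.inr (sdiff_subset_sdiff (topSet_mono h) Subset.rfl)

end Line

/-! ### Sorting the hypergrid along one direction -/

/-- The positions on the line through `x` in direction `i` at which `f` is `1`. -/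
def lineSet (i : Fin d) (f : BoolFn n d) (x : Point n d) : Finset (Fin n) :=
  univ.filter fun a => f (Function.update x i a) = true

/-- The function obtained from `f` by sorting its values on each line in direction `i`. -/
def sortAlong (i : Fin d) (f : BoolFn n d) : BoolFn n d :=
  fun x => decide (x i ∈ topSet n (lineSet i f x).card)

theorem mem_lineSet {i : Fin d} {f : BoolFn n d} {x : Point n d} {a : Fin n} :
    a ∈ lineSet i f x ↔ f (Function.update x i a) = true := by
  simp [lineSet]

theorem sortAlong_eq_true {i : Fin d} {f : BoolFn n d} {x : Point n d} :
    sortAlong i f x = true ↔ x i ∈ topSet n (lineSet i f x).card := by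
  simp [sortAlong]

theorem lineSet_update (i : Fin d) (f : BoolFn n d) (x : Point n d) (a : Fin n) :
    lineSet i f (Function.update x i a) = lineSet i f x := by
  simp [lineSet]

theorem lineSet_mono (i : Fin d) {f g : BoolFn n d} (h : f ≤ g) (x : Point n d) :
    lineSet i f x ⊆ lineSet i g x := by
  intro a
  simp only [mem_lineSet]
  exact fun ha => Bool.le_iff_imp.1 (h _) ha

theorem sortAlong_mono (i : Fin d) {f g : BoolFn n d} (h : f ≤ g) :
    sortAlong i f ≤ sortAlong i g := by
  intro x
  rw [Bool.le_iff_imp]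
  simp only [sortAlong_eq_true]
  exact fun hx => topSet_mono (card_le_card (lineSet_mono i h x)) hx

/-- On each line in direction `i`, the values of `U` are below all later values of `L`. -/
def Below (i : Fin d) (U L : BoolFn n d) : Prop :=
  ∀ x a, x i ≤ a → U x ≤ L (Function.update x i a)

theorem Below.le {i : Fin d} {U L : BoolFn n d} (h : Below i U L) : U ≤ L := by
  intro x
  have := h x (x i) le_rfl
  rwa [Function.update_eq_self] at this

theorem Below.sortAlong_of_ne {i j : Fin d} (hij : j ≠ i) {U L : BoolFn n d} (h : Below i U L) :
    Below i (sortAlong j U) (sortAlong j L) := by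
  intro x a hxa
  rw [Bool.le_iff_imp]
  simp only [sortAlong_eq_true, Function.update_of_ne hij]
  refine fun hx => topSet_mono (card_le_card fun b => ?_) hx
  simp only [mem_lineSet]
  intro hb
  have h' := Bool.le_iff_imp.1 (h (Function.update x j b) a
    (by rwa [Function.update_of_ne hij.symm])) hb
  rwa [Function.update_comm hij] at h'

/-- If `U x` is true, `L` is true at all `n - x i` positions from `x i` on, so its sorted line is
true at `x i`. The companion `Below.sortAlong_le` is the dual count. -/
theorem Below.le_sortAlong {i : Fin d} {U L : BoolFn n d} (h : Below i U L) :
    U ≤ sortAlong i L := by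
  intro x
  rw [Bool.le_iff_imp, sortAlong_eq_true, mem_topSet]
  intro hx
  have : (Ici (x i)) ⊆ lineSet i L x := by
    intro a ha
    rw [mem_lineSet]
    exact Bool.le_iff_imp.1 (h x a (mem_Ici.1 ha)) hx
  have := card_le_card this
  rw [Fin.card_Ici] at this
  omega

theorem Below.sortAlong_le {i : Fin d} {U L : BoolFn n d} (h : Below i U L) :
    sortAlong i U ≤ L := by
  intro x
  rw [Bool.le_iff_imp, sortAlong_eq_true, mem_topSet]
  intro hx
  by_contra hL
  have : lineSet i U x ⊆ Ioi (x i) := by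
    intro a ha
    rw [mem_lineSet] at ha
    rw [mem_Ioi]
    by_contra! hle
    have h' := Bool.le_iff_imp.1 (h (Function.update x i a) (x i) (by simpa using hle)) ha
    rw [Function.update_idem, Function.update_eq_self] at h'
    exact hL h'
  have := card_le_card this
  rw [Fin.card_Ioi] at this
  have := (x i).isLt
  omega

theorem below_sortAlong_self (i : Fin d) (f : BoolFn n d) :
    Below i (sortAlong i f) (sortAlong i f) := by
  intro x a hxa
  rw [Bool.le_iff_imp]
  simp only [sortAlong_eq_true, lineSet_update, Function.update_self, mem_topSet]
  have : (x i : ℕ) ≤ a := hxa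
  omega

theorem sortAlong_eq_self {i : Fin d} {f : BoolFn n d} (h : Below i f f) : sortAlong i f = f :=
  le_antisymm h.sortAlong_le h.le_sortAlong

/-- Move from `x` to `y` one coordinate at a time. -/
theorem monotone_of_below {f : BoolFn n d} (h : ∀ i, Below i f f) : Monotone f := by
  have key : ∀ (s : Finset (Fin d)) (x y : Point n d), x ≤ y → f x ≤ f (s.piecewise y x) := by
    intro s x y hxy
    induction s using Finset.induction_on with
    | empty => simp
    | insert i s hi ih =>
      rw [piecewise_insert]
      exact ih.trans (h i _ _ (by rw [piecewise_eq_of_notMem _ _ _ hi]; exact hxy i))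
  intro x y hxy
  simpa using key univ x y hxy

/-- Reduces inequalities between sums over the grid to inequalities on single lines. -/
theorem sum_sum_update {M : Type*} [AddCommMonoid M] (i : Fin d) (F : Point n d → M) :
    ∑ x, ∑ a, F (Function.update x i a) = n • ∑ x, F x := by
  -- The involution exchanges coordinate `i` of the point with the auxiliary value.
  let e : Point n d × Fin n ≃ Point n d × Fin n :=
    Function.Involutive.toPerm (fun p => (Function.update p.1 i p.2, p.1 i)) fun p => by simp
  have h : ∑ p : Point n d × Fin n, F (Function.update p.1 i p.2) =
      ∑ p : Point n d × Fin n, F p.1 := e.sum_comp fun p => F p.1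
  rw [Fintype.sum_prod_type, Fintype.sum_prod_type] at h
  rw [h, smul_sum]
  simp

theorem hammingDist_sortAlong_le (i : Fin d) (f g : BoolFn n d) :
    hammingDist (sortAlong i f) (sortAlong i g) ≤ hammingDist f g := by
  rcases Nat.eq_zero_or_pos n with rfl | hn
  · have : ∀ x : Point 0 d, sortAlong i f x = sortAlong i g x := fun x => (x i).elim0
    rw [funext this, hammingDist_self]
    exact Nat.zero_le _
  have e : ∀ f g : BoolFn n d, hammingDist f g = ∑ x, if f x ≠ g x then 1 else 0 := by
    intro f g
    rw [hammingDist, card_filter]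
  rw [e, e]
  refine Nat.le_of_mul_le_mul_left ?_ hn
  rw [← smul_eq_mul, ← smul_eq_mul, ← sum_sum_update i, ← sum_sum_update i]
  refine sum_le_sum fun x _ => ?_
  have h := card_topSet_ne_le (lineSet i f x) (lineSet i g x)
  rw [card_filter, card_filter] at h
  have hb : ∀ f g : BoolFn n d, ∀ y, (f y ≠ g y) ↔ ¬(f y = true ↔ g y = true) := by
    intro f g y
    rw [Ne, Bool.eq_iff_iff]
  simp only [hb, sortAlong_eq_true, lineSet_update, Function.update_self]
  simp only [mem_lineSet] at h
  exact h

/-! ### Marks and sorting along several directions -/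

/-- The number of directions in `R` that separate `U i` from `L i` at `x`. -/
def marks (R : Finset (Fin d)) (U L : Fin d → BoolFn n d) (x : Point n d) : ℕ :=
  (R.filter fun i => L i x = true ∧ ¬U i x = true).card

/-- The sum over all points of the square root of the number of marks. -/
noncomputable def markSum (R : Finset (Fin d)) (U L : Fin d → BoolFn n d) : ℝ :=
  ∑ x, √(marks R U L x : ℝ)

theorem markSum_sortAlong_le (R : Finset (Fin d)) (f : BoolFn n d) (U L : Fin d → BoolFn n d)
    (hU : ∀ i ∈ R, U i ≤ f) (hL : ∀ i ∈ R, f ≤ L i) (j : Fin d) :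
    markSum R (fun i => sortAlong j (U i)) (fun i => sortAlong j (L i)) ≤ markSum R U L := by
  rcases Nat.eq_zero_or_pos n with rfl | hn
  · have : IsEmpty (Point 0 d) := ⟨fun x => (x j).elim0⟩
    simp [markSum]
  have hn' : (0 : ℝ) < n := by exact_mod_cast hn
  refine le_of_mul_le_mul_left ?_ hn'
  rw [markSum, markSum, ← nsmul_eq_mul, ← nsmul_eq_mul, ← sum_sum_update j, ← sum_sum_update j]
  refine sum_le_sum fun x _ => ?_
  have h := sum_sqrt_topSet_le R (lineSet j f x) (fun i => lineSet j (U i) x)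
    (fun i => lineSet j (L i) x) (fun i hi => lineSet_mono j (hU i hi) x)
    (fun i hi => lineSet_mono j (hL i hi) x)
  simp only [marks, sortAlong_eq_true, lineSet_update, Function.update_self]
  simpa only [mem_sdiff, mem_lineSet] using h

/-- Sort `f` along the directions of the list `l` that belong to `S`, in the order of `l`. -/
def sortList (S : Finset (Fin d)) : List (Fin d) → BoolFn n d → BoolFn n d
  | [], f => f
  | i :: l, f => sortList S l (if i ∈ S then sortAlong i f else f)

theorem sortList_mono (S : Finset (Fin d)) (l : List (Fin d)) {f g : BoolFn n d} (h : f ≤ g) :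
    sortList S l f ≤ sortList S l g := by
  induction l generalizing f g with
  | nil => exact h
  | cons i l ih =>
    simp only [sortList]
    split_ifs
    · exact ih (sortAlong_mono i h)
    · exact ih h

theorem sortList_congr {S S' : Finset (Fin d)} {l : List (Fin d)}
    (h : ∀ i ∈ l, i ∈ S ↔ i ∈ S') (f : BoolFn n d) : sortList S l f = sortList S' l f := by
  induction l generalizing f with
  | nil => rfl
  | cons i l ih =>
    simp only [sortList, h i List.mem_cons_self]
    exact ih (fun j hj => h j (List.mem_cons_of_mem _ hj)) _

/-- If `S` and `S'` differ in the direction `i` only, then sorting `U` along `S` and `L` along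
`S'` turns the relation `Below i` into a pointwise inequality. -/
theorem Below.sortList_le {i : Fin d} {S S' : Finset (Fin d)} (hS : ∀ j, j ≠ i → (j ∈ S ↔ j ∈ S'))
    {l : List (Fin d)} (hl : l.Nodup) {U L : BoolFn n d} (h : Below i U L) :
    sortList S l U ≤ sortList S' l L := by
  induction l generalizing U L with
  | nil => exact h.le
  | cons j l ih =>
    rw [List.nodup_cons] at hl
    simp only [sortList]
    -- Before `i` both sides are sorted alike and `Below i` survives. At `i` it becomes a pointwise
    -- inequality; by `Nodup` the remaining sorts agree and preserve it.
    by_cases hj : j = i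
    · subst hj
      rw [sortList_congr (S := S) (S' := S') fun k hk => hS k fun e => hl.1 (e ▸ hk)]
      apply sortList_mono
      split_ifs
      · exact sortAlong_mono _ h.le
      · exact h.sortAlong_le
      · exact h.le_sortAlong
      · exact h.le
    · simp only [hS j hj]
      split_ifs
      · exact ih hl.2 (h.sortAlong_of_ne hj)
      · exact ih hl.2 h

theorem Below.sortList_self {i : Fin d} (S : Finset (Fin d)) (l : List (Fin d)) {f : BoolFn n d}
    (h : Below i f f) : Below i (sortList S l f) (sortList S l f) := by
  induction l generalizing f with
  | nil => exact h
  | cons j l ih =>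
    simp only [sortList]
    split_ifs
    · by_cases hj : j = i
      · subst hj
        exact ih (below_sortAlong_self _ _)
      · exact ih (h.sortAlong_of_ne hj)
    · exact ih h

theorem below_sortList {i : Fin d} {S : Finset (Fin d)} (hi : i ∈ S) {l : List (Fin d)}
    (hl : i ∈ l) (f : BoolFn n d) : Below i (sortList S l f) (sortList S l f) := by
  induction l generalizing f with
  | nil => simp at hl
  | cons j l ih =>
    simp only [sortList]
    rcases List.mem_cons.1 hl with rfl | hl
    · rw [if_pos hi]
      exact (below_sortAlong_self _ _).sortList_self S l
    · exact ih hl _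

theorem sortList_eq_self {S : Finset (Fin d)} {f : BoolFn n d} (h : ∀ i ∈ S, Below i f f)
    (l : List (Fin d)) : sortList S l f = f := by
  induction l with
  | nil => rfl
  | cons i l ih =>
    simp only [sortList]
    split_ifs with hi
    · rw [sortAlong_eq_self (h i hi), ih]
    · exact ih

theorem hammingDist_sortList_le (S : Finset (Fin d)) (l : List (Fin d)) (f g : BoolFn n d) :
    hammingDist (sortList S l f) (sortList S l g) ≤ hammingDist f g := by
  induction l generalizing f g with
  | nil => exact le_rfl
  | cons i l ih =>
    simp only [sortList]
    split_ifs
    · exact (ih _ _).trans (hammingDist_sortAlong_le i f g)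
    · exact ih _ _

theorem markSum_sortList_le (R S : Finset (Fin d)) (l : List (Fin d)) (f : BoolFn n d)
    (U L : Fin d → BoolFn n d) (hU : ∀ i ∈ R, U i ≤ f) (hL : ∀ i ∈ R, f ≤ L i) :
    markSum R (fun i => sortList S l (U i)) (fun i => sortList S l (L i)) ≤ markSum R U L := by
  induction l generalizing f U L with
  | nil => exact le_rfl
  | cons j l ih =>
    simp only [sortList]
    split_ifs
    · exact (ih (sortAlong j f) _ _ (fun i hi => sortAlong_mono j (hU i hi))
        fun i hi => sortAlong_mono j (hL i hi)).trans (markSum_sortAlong_le R f U L hU hL j)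
    · exact ih f U L hU hL

/-- Sort `f` along the directions in `S`, in increasing order. -/
def sortSet (S : Finset (Fin d)) (f : BoolFn n d) : BoolFn n d := sortList S (List.finRange d) f

theorem sortSet_eq_self {S : Finset (Fin d)} {f : BoolFn n d} (h : ∀ i ∈ S, Below i f f) :
    sortSet S f = f := sortList_eq_self h _

theorem below_sortSet {i : Fin d} {S : Finset (Fin d)} (hi : i ∈ S) (f : BoolFn n d) :
    Below i (sortSet S f) (sortSet S f) := below_sortList hi (List.mem_finRange i) f

theorem hammingDist_sortSet_le (S : Finset (Fin d)) (f g : BoolFn n d) :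
    hammingDist (sortSet S f) (sortSet S g) ≤ hammingDist f g := hammingDist_sortList_le S _ f g

/-! ### Covers and random classes of directions -/

/-- The functions `U i ≤ f ≤ L i` encode, for every direction `i ∈ R`, a set of marked points that
contains an end point of every violation of `f` in direction `i`: the marked points are those at
which `U i` and `L i` differ. -/
def IsCover (R : Finset (Fin d)) (f : BoolFn n d) (U L : Fin d → BoolFn n d) : Prop :=
  ∀ i ∈ R, U i ≤ f ∧ f ≤ L i ∧ Below i (U i) (L i)

theorem markSum_nonneg (R : Finset (Fin d)) (U L : Fin d → BoolFn n d) : 0 ≤ markSum R U L :=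
  sum_nonneg fun _ _ => Real.sqrt_nonneg _

theorem abs_indicator_sub_le {f f' u u' l l' : Bool} (h1 : u ≤ f) (h2 : f ≤ l) (h3 : u' ≤ f')
    (h4 : f' ≤ l') (h5 : u ≤ l') (h6 : u' ≤ l) :
    |(if f = true then (1 : ℝ) else 0) - if f' = true then (1 : ℝ) else 0| ≤
      (if l = true ∧ ¬u = true then (1 : ℝ) else 0) +
        if l' = true ∧ ¬u' = true then (1 : ℝ) else 0 := by
  revert h1 h2 h3 h4 h5 h6
  cases f <;> cases f' <;> cases u <;> cases u' <;> cases l <;> cases l' <;> simp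

section Classes

variable {Ω : Type*} [DecidableEq Ω]

/-- The elements of `R` to which `c` assigns the label `a`. -/
def labelClass (R : Finset (Fin d)) (a : Ω) (c : Fin d → Ω) : Finset (Fin d) :=
  R.filter fun i => c i = a

theorem labelClass_swap (R : Finset (Fin d)) (a b : Ω) (c : Fin d → Ω) :
    labelClass R a (Equiv.swap a b ∘ c) = labelClass R b c := by
  ext i
  simp only [labelClass, mem_filter, Function.comp]
  rw [Equiv.swap_apply_eq_iff, Equiv.swap_apply_left]

/-- Sorting successively along all classes of a labelling changes the function sorted along one
class only by its distance to the functions sorted along the other classes. -/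
theorem exists_below_labelClass (R : Finset (Fin d)) (c : Fin d → Ω) (f g : BoolFn n d)
    (A : Finset Ω) :
    ∃ G : BoolFn n d, (∀ a ∈ A, ∀ i ∈ labelClass R a c, Below i G G) ∧
      hammingDist g G ≤ 2 * ∑ a ∈ A, hammingDist g (sortSet (labelClass R a c) f) := by
  induction A using Finset.induction_on with
  | empty => exact ⟨g, by simp, by simp⟩
  | insert a A ha ih =>
    obtain ⟨G, hG, hdist⟩ := ih
    refine ⟨sortSet (labelClass R a c) G, fun b hb i hi => ?_, ?_⟩
    · rcases mem_insert.1 hb with rfl | hb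
      · exact below_sortSet hi G
      · exact (hG b hb i hi).sortList_self _ _
    · rw [sum_insert ha]
      set s := sortSet (labelClass R a c) (n := n) with hs
      have h1 := hammingDist_sortSet_le (labelClass R a c) g G
      have h2 := hammingDist_sortSet_le (labelClass R a c) g (s f)
      -- The path `g`, `s f = s (s f)`, `s g`, `s G` costs `hammingDist g (s f)` twice and
      -- `hammingDist g G` once, since `s` is a contraction.
      have h3 : s (s f) = s f := sortSet_eq_self fun i hi => below_sortSet hi f
      rw [← hs] at h1 h2
      rw [h3] at h2
      have t1 := hammingDist_triangle g (s f) (s G)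
      have t2 := hammingDist_triangle (s f) (s g) (s G)
      rw [hammingDist_comm (s f) (s g)] at t2
      omega

variable [Fintype Ω]

theorem mean_labelClass_eq (R : Finset (Fin d)) (a b : Ω) (F : Finset (Fin d) → ℝ) :
    (mean fun c : Fin d → Ω => F (labelClass R a c)) =
      mean fun c : Fin d → Ω => F (labelClass R b c) := by
  rw [← mean_equiv ((Equiv.refl (Fin d)).arrowCongr (Equiv.swap a b))]
  simp only [Equiv.arrowCongr, Equiv.coe_fn_mk, Equiv.refl_symm, Equiv.coe_refl, Function.comp_id,
    labelClass_swap]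

theorem mean_indicator_label (i : Fin d) (a : Ω) :
    (mean fun c : Fin d → Ω => if c i = a then (1 : ℝ) else 0) = (Fintype.card Ω : ℝ)⁻¹ := by
  have : Nonempty Ω := ⟨a⟩
  have key : ∀ b, (mean fun c : Fin d → Ω => if c i = b then (1 : ℝ) else 0) =
      mean fun c : Fin d → Ω => if c i = a then (1 : ℝ) else 0 := by
    intro b
    have := mean_labelClass_eq univ b a (fun S => if i ∈ S then (1 : ℝ) else 0)
    simpa [labelClass] using this
  have hsum := mean_sum univ fun (b : Ω) (c : Fin d → Ω) => if c i = b then (1 : ℝ) else 0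
  simp only [sum_ite_eq, mem_univ, if_true, mean_const, key, sum_const, card_univ,
    nsmul_eq_mul] at hsum
  exact eq_inv_of_mul_eq_one_right hsum.symm

/-- Each mark survives with probability `1/|Ω|`; Jensen's inequality moves the mean inside the
square root. -/
theorem mean_markSum_labelClass_le (R : Finset (Fin d)) (a : Ω) (U L : Fin d → BoolFn n d) :
    (mean fun c : Fin d → Ω => markSum (labelClass R a c) U L) ≤
      markSum R U L / √(Fintype.card Ω) := by
  have : Nonempty Ω := ⟨a⟩
  simp only [markSum]
  rw [mean_sum, sum_div]
  refine sum_le_sum fun x _ => ?_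
  refine (mean_sqrt_le _ fun c => Nat.cast_nonneg _).trans_eq ?_
  rw [← Real.sqrt_div (Nat.cast_nonneg _)]
  congr 1
  have e : (fun c : Fin d → Ω => (marks (labelClass R a c) U L x : ℝ)) = fun c =>
      ∑ i ∈ R.filter fun i => L i x = true ∧ ¬U i x = true, if c i = a then (1 : ℝ) else 0 := by
    funext c
    rw [marks, labelClass, filter_comm, card_filter]
    push_cast
    rfl
  rw [e, mean_sum]
  simp only [mean_indicator_label, sum_const, nsmul_eq_mul, marks, div_eq_mul_inv]

theorem hammingDist_eq_sum (f g : BoolFn n d) :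
    (hammingDist f g : ℝ) =
      ∑ x, ((if f x = true then (1 : ℝ) else 0) - if g x = true then (1 : ℝ) else 0) ^ 2 := by
  rw [hammingDist, card_filter]
  push_cast
  refine sum_congr rfl fun x _ => ?_
  cases f x <;> cases g x <;> simp

/-- Sorting `f` along two independent random sets of directions gives close functions. -/
theorem mean_mean_hammingDist_le (R : Finset (Fin d)) (a : Ω) (f : BoolFn n d)
    (U L : Fin d → BoolFn n d) (h : IsCover R f U L) :
    (mean fun c : Fin d → Ω => mean fun c' : Fin d → Ω =>
      (hammingDist (sortSet (labelClass R a c) f) (sortSet (labelClass R a c') f) : ℝ)) ≤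
      2 * Fintype.card Ω * markSum R U L := by
  have : Nonempty Ω := ⟨a⟩
  let s : (Fin d → Ω) → BoolFn n d → BoolFn n d := fun c => sortSet (labelClass R a c)
  let g : Point n d → (Fin d → Ω) → ℝ := fun x c => if s c f x = true then 1 else 0
  let W : Point n d → Fin d → (Fin d → Ω) → ℝ := fun x i c =>
    if i ∈ R ∧ s c (L i) x = true ∧ ¬s c (U i) x = true then 1 else 0
  have hW0 : ∀ x i c, 0 ≤ W x i c := fun x i c => by simp only [W]; split_ifs <;> norm_num
  -- Relabelling `i` changes the sorted class at most in `i`, so `Below.sortList_le` compares the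
  -- sorted `U i` and `L i` across the two labellings.
  have hcov : ∀ x i c b, |g x c - g x (Function.update c i b)| ≤
      W x i c + W x i (Function.update c i b) := by
    intro x i c b
    set c' := Function.update c i b
    have hS : ∀ j, j ≠ i → (j ∈ labelClass R a c ↔ j ∈ labelClass R a c') := by
      intro j hj
      simp only [labelClass, mem_filter, c', Function.update_of_ne hj]
    by_cases hi : i ∈ R
    · obtain ⟨hU, hL, hB⟩ := h i hi
      have b1 := sortList_mono (labelClass R a c) (List.finRange d) hU x
      have b2 := sortList_mono (labelClass R a c) (List.finRange d) hL x
      have b3 := sortList_mono (labelClass R a c') (List.finRange d) hU x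
      have b4 := sortList_mono (labelClass R a c') (List.finRange d) hL x
      have b5 := hB.sortList_le hS (List.nodup_finRange d) x
      have b6 := hB.sortList_le (fun j hj => (hS j hj).symm) (List.nodup_finRange d) x
      simp only [g, W, s, hi, true_and]
      simp only [sortSet]
      exact abs_indicator_sub_le b1 b2 b3 b4 b5 b6
    · have e : labelClass R a c = labelClass R a c' := by
        ext j
        by_cases hj : j = i
        · subst hj; simp [labelClass, hi]
        · exact hS j hj
      have : g x c = g x c' := by simp only [g, s, e]
      rw [this, sub_self, abs_zero]
      exact add_nonneg (hW0 _ _ _) (hW0 _ _ _)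
  have hvar : ∀ x, (mean fun c => mean fun c' => (g x c - g x c') ^ 2) ≤
      2 * Fintype.card Ω * mean fun c =>
        √(marks R (fun i => s c (U i)) (fun i => s c (L i)) x : ℝ) := by
    intro x
    have h0 : ∀ c, 0 ≤ g x c := fun c => by simp only [g]; split_ifs <;> norm_num
    have h1 : ∀ c, g x c ≤ 1 := fun c => by simp only [g]; split_ifs <;> norm_num
    have := variance_le_mean_sqrt d (g x) h0 h1 (W x) (hW0 x) (hcov x)
    have e : (fun c => √(∑ i, W x i c ^ 2)) = fun c =>
        √(marks R (fun i => s c (U i)) (fun i => s c (L i)) x : ℝ) := by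
      funext c
      congr 1
      simp only [W, ite_pow, one_pow, ne_eq, OfNat.ofNat_ne_zero, not_false_eq_true, zero_pow,
        marks, sum_boole]
      congr 2
      ext i
      simp
    rw [e] at this
    rw [mean_mean_sq_sub]
    linarith
  have e1 : (mean fun c : Fin d → Ω => mean fun c' : Fin d → Ω =>
      (hammingDist (s c f) (s c' f) : ℝ)) =
      ∑ x, mean fun c => mean fun c' => (g x c - g x c') ^ 2 := by
    simp only [hammingDist_eq_sum, mean_sum, g]
  change (mean fun c : Fin d → Ω => mean fun c' : Fin d → Ω =>
      (hammingDist (s c f) (s c' f) : ℝ)) ≤ _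
  rw [e1]
  refine (sum_le_sum fun x _ => hvar x).trans ?_
  rw [← mul_sum, ← mean_sum]
  refine mul_le_mul_of_nonneg_left ?_ (by positivity)
  rw [← mean_const (α := Fin d → Ω) (markSum R U L)]
  exact mean_mono fun c => markSum_sortList_le R _ _ f U L (fun i hi => (h i hi).1)
    fun i hi => (h i hi).2.1

/-- Classes `a` and `b` of one labelling are dependent, but each can be compared with class `a` of
an independent labelling; all classes have the same distribution. -/
theorem mean_hammingDist_labelClass_le (R : Finset (Fin d)) (a b : Ω) (f : BoolFn n d)
    (U L : Fin d → BoolFn n d) (h : IsCover R f U L) :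
    (mean fun c : Fin d → Ω =>
      (hammingDist (sortSet (labelClass R a c) f) (sortSet (labelClass R b c) f) : ℝ)) ≤
      4 * Fintype.card Ω * markSum R U L := by
  have : Nonempty Ω := ⟨a⟩
  let s : Ω → (Fin d → Ω) → BoolFn n d := fun a c => sortSet (labelClass R a c) f
  have key := mean_mean_hammingDist_le R a f U L h
  have e2 : (mean fun c : Fin d → Ω => mean fun c' : Fin d → Ω =>
      (hammingDist (s b c) (s a c') : ℝ)) =
      mean fun c : Fin d → Ω => mean fun c' : Fin d → Ω => (hammingDist (s a c) (s a c') : ℝ) :=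
    mean_labelClass_eq R b a fun S => mean fun c' : Fin d → Ω =>
      (hammingDist (sortSet S f) (s a c') : ℝ)
  calc (mean fun c : Fin d → Ω => (hammingDist (s a c) (s b c) : ℝ))
      ≤ mean fun c : Fin d → Ω => (mean fun c' : Fin d → Ω => (hammingDist (s a c) (s a c') : ℝ))
          + mean fun c' : Fin d → Ω => (hammingDist (s b c) (s a c') : ℝ) := by
        refine mean_mono fun c => ?_
        rw [← mean_add, ← mean_const (α := Fin d → Ω) (hammingDist (s a c) (s b c) : ℝ)]
        refine mean_mono fun c' => ?_
        rw [hammingDist_comm (s b c)]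
        exact_mod_cast hammingDist_triangle _ _ _
    _ ≤ 4 * Fintype.card Ω * markSum R U L := by
        rw [mean_add, e2]
        linarith

end Classes

/-! ### Bootstrapping the constant -/

/-- The isoperimetric inequality with constant `K`. -/
def DistBound (n d : ℕ) (K : ℝ) : Prop :=
  ∀ (R : Finset (Fin d)) (f : BoolFn n d) (U L : Fin d → BoolFn n d), IsCover R f U L →
    ∃ G : BoolFn n d, (∀ i ∈ R, Below i G G) ∧ (hammingDist f G : ℝ) ≤ K * markSum R U L

/-- Without any mark, `U i` and `L i` both equal `f` for `i ∈ R`, and the cover condition says that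
`f` is already sorted. This gives the crude constant that starts the iteration. -/
theorem one_le_markSum {R : Finset (Fin d)} {f : BoolFn n d} {U L : Fin d → BoolFn n d}
    (h : IsCover R f U L) (hf : ¬∀ i ∈ R, Below i f f) : 1 ≤ markSum R U L := by
  have key : ∃ i ∈ R, ∃ x, L i x = true ∧ ¬U i x = true := by
    by_contra! hno
    refine hf fun i hi x a hxa => ?_
    obtain ⟨hU, hL, hB⟩ := h i hi
    exact (hL x).trans ((Bool.le_iff_imp.2 (hno i hi x)).trans ((hB x a hxa).trans
      ((Bool.le_iff_imp.2 (hno i hi _)).trans (hU _))))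
  obtain ⟨i, hi, x, hx⟩ := key
  have h1 : 1 ≤ marks R U L x := card_pos.2 ⟨i, mem_filter.2 ⟨hi, hx⟩⟩
  calc (1 : ℝ) ≤ √(marks R U L x : ℝ) := Real.one_le_sqrt.2 (by exact_mod_cast h1)
    _ ≤ markSum R U L := single_le_sum (f := fun x => √(marks R U L x : ℝ))
        (fun _ _ => Real.sqrt_nonneg _) (mem_univ x)

theorem distBound_card (n d : ℕ) : DistBound n d (Fintype.card (Point n d)) := by
  intro R f U L h
  by_cases hf : ∀ i ∈ R, Below i f f
  · refine ⟨f, hf, ?_⟩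
    rw [hammingDist_self, Nat.cast_zero]
    exact mul_nonneg (Nat.cast_nonneg _) (markSum_nonneg R U L)
  · refine ⟨sortSet R f, fun i hi => below_sortSet hi f, ?_⟩
    have h1 := one_le_markSum h hf
    have h2 : (hammingDist f (sortSet R f) : ℝ) ≤ Fintype.card (Point n d) := by
      exact_mod_cast hammingDist_le_card_fintype
    nlinarith [(Nat.cast_nonneg (Fintype.card (Point n d)) : (0 : ℝ) ≤ _)]

theorem DistBound.improve {K : ℝ} (hK0 : 0 ≤ K) (hK : DistBound n d K) : DistBound n d (K / 2 + 2048) := by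
  intro R f U L h
  -- With 16 labels the recursive term is `2 * K / √16 = K / 2`, and the distances between classes
  -- add `2 * 16 * (4 * 16) = 2048`.
  let s : Fin 16 → (Fin d → Fin 16) → BoolFn n d := fun a c => sortSet (labelClass R a c) f
  let E : (Fin d → Fin 16) → ℝ := fun c =>
    2 * (K * markSum (labelClass R 0 c) U L) + 2 * ∑ a, (hammingDist (s 0 c) (s a c) : ℝ)
  have hG : ∀ c, ∃ G : BoolFn n d, (∀ i ∈ R, Below i G G) ∧ (hammingDist f G : ℝ) ≤ E c := by
    intro c
    obtain ⟨G, hG, hdist⟩ := exists_below_labelClass R c f (s 0 c) univ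
    refine ⟨G, fun i hi => hG (c i) (mem_univ _) i (by simp [labelClass, hi]), ?_⟩
    obtain ⟨G', hG', hdist'⟩ := hK (labelClass R 0 c) f U L
      fun i hi => h i (mem_filter.1 hi).1
    have h1 := hammingDist_sortSet_le (labelClass R 0 c) f G'
    rw [sortSet_eq_self hG'] at h1
    -- Sorting along class 0 is a contraction fixing `G'`, so `f` and `s 0 c` are equally well
    -- approximated by `G'`.
    have h2 : hammingDist f (s 0 c) ≤ 2 * hammingDist f G' := by
      have := hammingDist_triangle f G' (s 0 c)
      rw [hammingDist_comm G'] at this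
      change hammingDist (s 0 c) G' ≤ _ at h1
      omega
    have h3 := hammingDist_triangle f (s 0 c) G
    have h4 : (hammingDist f G : ℝ) ≤ 2 * hammingDist f G' +
        2 * ∑ a, (hammingDist (s 0 c) (s a c) : ℝ) := by
      exact_mod_cast h3.trans (add_le_add h2 hdist)
    simp only [E]
    linarith
  have hmean : mean E ≤ (K / 2 + 2048) * markSum R U L := by
    have m1 := mean_markSum_labelClass_le R (0 : Fin 16) U L
    have m2 : ∑ a : Fin 16, (mean fun c => (hammingDist (s 0 c) (s a c) : ℝ)) ≤
        ∑ _a : Fin 16, 4 * Fintype.card (Fin 16) * markSum R U L :=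
      sum_le_sum fun a _ => mean_hammingDist_labelClass_le R 0 a f U L h
    have h16 : √((Fintype.card (Fin 16) : ℕ) : ℝ) = 4 := by
      rw [Fintype.card_fin, show ((16 : ℕ) : ℝ) = 4 ^ 2 by norm_num,
        Real.sqrt_sq (by norm_num)]
    rw [h16] at m1
    simp only [sum_const, card_univ, Fintype.card_fin, nsmul_eq_mul] at m2
    push_cast at m2
    simp only [E]
    rw [mean_add, mean_mul_left, mean_mul_left, mean_mul_left, mean_sum]
    have m3 := mul_le_mul_of_nonneg_left m1 hK0
    linarith
  obtain ⟨c, hc⟩ := exists_le_mean E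
  obtain ⟨G, hG, hdist⟩ := hG c
  exact ⟨G, hG, hdist.trans (hc.trans hmean)⟩

theorem distBound_halving (n d m : ℕ) :
    DistBound n d (4096 + Fintype.card (Point n d) / 2 ^ m) := by
  induction m with
  | zero =>
    intro R f U L h
    obtain ⟨G, hG, hdist⟩ := distBound_card n d R f U L h
    refine ⟨G, hG, hdist.trans (mul_le_mul_of_nonneg_right ?_ (markSum_nonneg R U L))⟩
    simp
  | succ m ih =>
    -- 4096 is the fixed point of `K ↦ K / 2 + 2048`, so only the excess is halved.
    have := ih.improve (by positivity)
    convert this using 1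
    rw [pow_succ]
    ring

/-- A lower bound for the Hamming distance to all monotone functions is at most `4096` times the
sum of the square roots of the number of marks. -/
theorem le_markSum_of_forall_monotone {f : BoolFn n d} {U L : Fin d → BoolFn n d}
    (h : IsCover univ f U L) {δ : ℝ} (hδ : ∀ G : BoolFn n d, Monotone G → δ ≤ hammingDist f G) :
    δ ≤ 4096 * markSum univ U L := by
  have hm : ∀ m : ℕ, δ ≤ (4096 + Fintype.card (Point n d) * (1 / 2) ^ m) * markSum univ U L := by
    intro m
    obtain ⟨G, hG, hdist⟩ := distBound_halving n d m univ f U L h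
    rw [one_div, inv_pow, ← div_eq_mul_inv]
    exact (hδ G (monotone_of_below fun i => hG i (mem_univ i))).trans hdist
  refine ge_of_tendsto' (x := Filter.atTop) ?_ hm
  have t := tendsto_pow_atTop_nhds_zero_of_lt_one (r := (1 / 2 : ℝ)) (by norm_num) (by norm_num)
  simpa using ((t.const_mul (Fintype.card (Point n d) : ℝ)).const_add 4096).mul_const
    (markSum univ U L)

/-! ### From colorings to covers, and the conclusion -/

section Coloring

variable (f : BoolFn n d) (χ : Coloring n d)

/-- The part of `f⁻¹(1)` that is not marked by the coloring in direction `i`. -/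
noncomputable def lowerFn (i : Fin d) : BoolFn n d :=
  fun x => f x && decide (influenceAt f χ x i = 0)

/-- The union of `f⁻¹(1)` and the set of points marked by the coloring in direction `i`. -/
noncomputable def upperFn (i : Fin d) : BoolFn n d :=
  fun x => f x || decide (influenceAt f χ x i ≠ 0)

theorem influenceAt_eq_zero {x : Point n d} {i : Fin d} : influenceAt f χ x i = 0 ↔
    ∀ (y : Point n d) (h : Aligned i x y), Violation f x y → χ h.edge ≠ f x := by
  simp only [influenceAt, ite_eq_right_iff, one_ne_zero, imp_false, not_exists, not_and, ne_eq]

/-- The color of a violating edge equals the value of `f` at exactly one endpoint, so one endpoint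
is marked. Hence an unmarked 1 cannot lie below an unmarked 0 on a line. -/
theorem isCover_coloring : IsCover univ f (lowerFn f χ) (upperFn f χ) := by
  intro i _
  refine ⟨fun x => ?_, fun x => ?_, fun x a hxa => ?_⟩
  · rw [Bool.le_iff_imp]
    simp only [lowerFn, Bool.and_eq_true]
    exact fun h => h.1
  · rw [Bool.le_iff_imp]
    simp only [upperFn, Bool.or_eq_true]
    exact Or.inl
  · rw [Bool.le_iff_imp]
    simp only [lowerFn, upperFn, Bool.and_eq_true, Bool.or_eq_true, decide_eq_true_eq]
    rintro ⟨hx, hx0⟩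
    set y := Function.update x i a with hy
    by_contra! hcon
    obtain ⟨hfy, hy0⟩ := hcon
    replace hfy := Bool.eq_false_of_not_eq_true hfy
    have hne : x i ≠ a := by
      rintro rfl
      rw [hy, Function.update_eq_self, hx] at hfy
      exact Bool.noConfusion hfy
    have hal : Aligned i x y :=
      ⟨by rwa [hy, Function.update_self], fun j hj => by rw [hy, Function.update_of_ne hj]⟩
    have hle : x ≤ y := by
      intro j
      by_cases hj : j = i
      · subst hj
        rwa [hy, Function.update_self]
      · rw [hal.2 j hj]
    have h1 := (influenceAt_eq_zero f χ).1 hx0 y hal (Or.inl ⟨hle, hx, hfy⟩)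
    have h2 := (influenceAt_eq_zero f χ).1 hy0 x hal.symm (Or.inr ⟨hle, hx, hfy⟩)
    have he : hal.symm.edge = hal.edge := Subtype.ext Sym2.eq_swap
    rw [he] at h2
    rw [hx] at h1
    rw [hfy] at h2
    cases hχ : χ hal.edge
    · exact h2 hχ
    · exact h1 hχ

theorem marks_coloring (x : Point n d) :
    marks univ (lowerFn f χ) (upperFn f χ) x = influence f χ x := by
  rw [marks, influence, card_filter]
  refine sum_congr rfl fun i _ => ?_
  have h01 : influenceAt f χ x i = 0 ∨ influenceAt f χ x i = 1 := by
    rw [influenceAt]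
    split_ifs <;> simp
  rcases h01 with h | h <;> cases hf : f x <;> simp [lowerFn, upperFn, h, hf]

end Coloring

theorem talagrandObjective_eq (f : BoolFn n d) (χ : Coloring n d) :
    talagrandObjective f χ = markSum univ (lowerFn f χ) (upperFn f χ) / (n : ℝ) ^ d := by
  simp only [talagrandObjective, markSum, marks_coloring]

theorem distToMonotone_le (f : BoolFn n d) {g : BoolFn n d} (hg : Monotone g) :
    distToMonotone f ≤ hammingDist f g / (n : ℝ) ^ d :=
  ciInf_le ⟨0, by rintro _ ⟨g, rfl⟩; unfold dist; positivity⟩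
    (⟨g, hg⟩ : {g : BoolFn n d // Monotone g})

theorem le_talagrandObjective (hn : 0 < n) (f : BoolFn n d) (χ : Coloring n d) {ε : ℝ}
    (hf : IsFar ε f) : ε / 4096 ≤ talagrandObjective f χ := by
  have hN : (0 : ℝ) < (n : ℝ) ^ d := by positivity
  have h := le_markSum_of_forall_monotone (isCover_coloring f χ) (δ := ε * (n : ℝ) ^ d)
    fun G hG => (le_div_iff₀ hN).1 (le_trans hf (distToMonotone_le f hG))
  rw [talagrandObjective_eq, le_div_iff₀ hN]
  linarith

end Hypergrid

theorem theorem1p2 :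
    ∃ C : ℝ, 0 < C ∧
      ∀ (n d : ℕ), 2 ≤ n →
        ∀ (f : Hypergrid.BoolFn n d) (χ : Hypergrid.Coloring n d) (ε : ℝ), 0 < ε →
          Hypergrid.IsFar ε f →
            C * (ε / Real.log n) ≤ Hypergrid.talagrandObjective f χ := by
  have hlog2 : 0 < Real.log 2 := Real.log_pos (by norm_num)
  -- The bound `ε / 4096` is free of `n`; the factor `log 2` only absorbs `1 / log n ≤ 1 / log 2`.
  refine ⟨Real.log 2 / 4096, by positivity, fun n d hn f χ ε hε hf => ?_⟩
  refine le_trans ?_ (Hypergrid.le_talagrandObjective (by omega) f χ hf)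
  have hlog : Real.log 2 ≤ Real.log n :=
    Real.log_le_log (by norm_num) (by exact_mod_cast hn)
  have hpos : 0 < Real.log n := hlog2.trans_le hlog
  calc Real.log 2 / 4096 * (ε / Real.log n) = ε / 4096 * (Real.log 2 / Real.log n) := by ring
    _ ≤ ε / 4096 * 1 := by gcongr; exact (div_le_one hpos).2 hlog
    _ = ε / 4096 := mul_one _
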